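/- Let ${\bf F}={\bf R}$ or ${\bf F}={\bf C}$. For a set $S\subset(0,\infty)$ let $M_{S,C}$ denote the completion, relative to the maximum norm on $[0,1]$, of the ${\bf F}$-linear span of the monomials $t^{s}$, $s\in S$; that is, $M_{S,C}$ is the closure of this span in $C([0,1],{\bf F})$. Let $\Lambda=\{\lambda_k: k\in{\bf N}\}$, where $(\lambda_k)_{k\ge 1}$ is an increasing sequence in $(0,\infty)$ that satisfies the gap condition $\inf_k(\lambda_{k+1}-\lambda_k)>0$ and the Müntz condition $\sum_{k=1}^{\infty}\lambda_k^{-1}<\infty$. Then for all real $\alpha>0$ and $\beta\ge 0$ and every finite set $\Xi\subset(0,\infty)$, the Müntz spaces $M_{\Lambda,C}$ and $M_{\Xi\cup(\alpha\Lambda+\beta),C}$, where $\alpha\Lambda+\beta=\{\alpha\lambda+\beta:\lambda\in\Lambda\}$, are isomorphic as Banach spaces, i.e. there is a linear homeomorphism from one onto the other. -/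

import Mathlib

open scoped unitInterval

/-- The monomials `t ↦ t ^ l` on `[0, 1]`, `l ∈ S`, as elements of the Banach space
`C([0, 1], 𝕜)` with the maximum norm. -/
def muntzMonomials (𝕜 : Type*) [RCLike 𝕜] (S : Set ℝ) : Set C(I, 𝕜) :=
  {f | ∃ l ∈ S, ∀ t : I, f t = (((t : ℝ) ^ l : ℝ) : 𝕜)}

/-- The Müntz space of the exponent set `S ⊆ (0, ∞)` on `[0, 1]`: the completion, for the maximum
norm, of the linear span of the monomials with exponents in `S`, realised as the closure of that
span in `C([0, 1], 𝕜)`. -/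
def muntzSpace (𝕜 : Type*) [RCLike 𝕜] (S : Set ℝ) : Submodule 𝕜 C(I, 𝕜) :=
  (Submodule.span 𝕜 (muntzMonomials 𝕜 S)).topologicalClosure

/-- The gap condition `inf_k (l (k + 1) - l k) > 0`, for a sequence that is increasing. -/
def GapCondition (l : ℕ → ℝ) : Prop :=
  0 < ⨅ k : ℕ, (l (k + 1) - l k)

/-- The Müntz condition `∑ 1 / l k < ∞`, for a sequence of positive reals. -/
def MuntzCondition (l : ℕ → ℝ) : Prop :=
  Summable fun k : ℕ => 1 / l k

/-!
Three kinds of isomorphism are composed.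

* Dilating the exponents by `α > 0` is the change of variables `t = u ^ α`, an isometry
  (`nonempty_muntzSpace_equiv_mul`).
* Translating the exponents by `β ≥ 0` is multiplication by `t ^ β`, and what has to be shown is that
  it is bounded below on Müntz polynomials `p = ∑ aₖ t ^ lₖ` (`exists_norm_le_norm_powMap_mul`). The
  coefficients of `t ^ β p` satisfy `|aₖ| ≤ exp (D (lₖ + β + 1)) ‖t ^ β p‖` by
  `exists_norm_coeff_le`, so `p` is controlled by the sum of its terms for `t` below some fixed
  `δ > 0`; for `t ≥ δ` one divides by `t ^ β`. The coefficient bound comes from `L²(0, 1)`: the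
  multiplier `(x - c) / (x + c + 1)` annihilates `t ^ c` and is a contraction
  (`gram_multiplier_le`), so all powers but one can be removed without increasing the norm. The gap
  and Müntz conditions bound the resulting product (`exists_prod_le`).
* Adjoining one exponent to an unbounded set either changes nothing or adds a one-dimensional
  summand. The latter is absorbed because a Müntz space with unbounded exponents contains a
  complemented copy of `c₀` (`nonempty_muntzSpace_equiv_prod`), and `c₀` is isomorphic to
  `c₀ × 𝕜` by the shift.
-/

/-! ### Isomorphisms of Banach spaces -/

section Banach

variable {𝕜 E F : Type*} [RCLike 𝕜] [NormedAddCommGroup E] [NormedSpace 𝕜 E]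
  [NormedAddCommGroup F] [NormedSpace 𝕜 F]

open scoped ZeroAtInfty

/-- A bounded operator that is bounded below on the span of `A` maps the closed span of `A`
isomorphically onto the closed span of the image of `A`. -/
theorem nonempty_equiv_closure_span_image [CompleteSpace E] [CompleteSpace F] (T : E →L[𝕜] F)
    (A : Set E) (K : ℝ) (hK : ∀ x ∈ Submodule.span 𝕜 A, ‖x‖ ≤ K * ‖T x‖) :
    Nonempty ((Submodule.span 𝕜 A).topologicalClosure ≃L[𝕜]
      (Submodule.span 𝕜 (T '' A)).topologicalClosure) := by
  set X := (Submodule.span 𝕜 A).topologicalClosure with hX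
  set Y := (Submodule.span 𝕜 (T '' A)).topologicalClosure with hY
  have : CompleteSpace X := (Submodule.isClosed_topologicalClosure _).completeSpace_coe
  have : CompleteSpace Y := (Submodule.isClosed_topologicalClosure _).completeSpace_coe
  have hspan : ∀ x ∈ Submodule.span 𝕜 A, T x ∈ Submodule.span 𝕜 (T '' A) := by
    intro x hx
    have := Submodule.mem_map_of_mem (f := (T : E →ₗ[𝕜] F)) hx
    rwa [Submodule.map_span] at this
  have hmaps : ∀ x : X, T x ∈ Y := by
    intro x
    exact map_mem_closure T.continuous x.2 hspan
  have hbd : ∀ x : X, ‖(x : E)‖ ≤ K * ‖T x‖ := by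
    intro x
    have hcl : IsClosed {x : E | ‖x‖ ≤ K * ‖T x‖} :=
      isClosed_le continuous_norm (continuous_const.mul T.continuous.norm)
    exact closure_minimal hK hcl x.2
  let S : X →L[𝕜] Y := (T.comp X.subtypeL).codRestrict Y hmaps
  have hS : AntilipschitzWith K.toNNReal S := by
    refine ContinuousLinearMap.antilipschitz_of_bound _ fun x => ?_
    refine (hbd x).trans ?_
    exact mul_le_mul_of_nonneg_right (Real.le_coe_toNNReal K) (norm_nonneg _)
  have hclosed : IsClosed (Set.range S) := hS.isClosed_range S.uniformContinuous
  have hsurj : Function.Surjective S := by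
    have hcl : IsClosed ((S.range.map Y.subtype : Submodule 𝕜 F) : Set F) := by
      have : ((S.range.map Y.subtype : Submodule 𝕜 F) : Set F) = Subtype.val '' Set.range S := by
        ext z; simp
      rw [this]
      exact (Submodule.isClosed_topologicalClosure _).isClosedEmbedding_subtypeVal.isClosedMap _
        hclosed
    have hle : Y ≤ S.range.map Y.subtype := by
      refine Submodule.topologicalClosure_minimal _ (Submodule.span_le.2 ?_) hcl
      rintro _ ⟨a, ha, rfl⟩
      let a' : X := ⟨a, Submodule.le_topologicalClosure _ (Submodule.subset_span ha)⟩
      exact ⟨S a', ⟨a', rfl⟩, rfl⟩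
    intro y
    obtain ⟨z, ⟨x, hx⟩, hz⟩ := hle y.2
    exact ⟨x, Subtype.ext (by rw [← hz, ← hx]; rfl)⟩
  exact ⟨ContinuousLinearEquiv.ofBijective S
    (LinearMap.ker_eq_bot.2 hS.injective) (LinearMap.range_eq_top.2 hsurj)⟩

/-- If `Y` absorbs a one-dimensional summand, so does every space containing `Y` as a retract. -/
theorem nonempty_equiv_prod_of_retract {Y : Type*} [NormedAddCommGroup Y] [NormedSpace 𝕜 Y]
    (e : Y ≃L[𝕜] Y × 𝕜) (R : E →L[𝕜] Y) (J : Y →L[𝕜] E) (hRJ : ∀ y, R (J y) = y) :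
    Nonempty (E ≃L[𝕜] E × 𝕜) := by
  let f₁ : Y →L[𝕜] Y := (ContinuousLinearMap.fst 𝕜 Y 𝕜).comp (e : Y →L[𝕜] Y × 𝕜)
  let f₂ : Y →L[𝕜] 𝕜 := (ContinuousLinearMap.snd 𝕜 Y 𝕜).comp (e : Y →L[𝕜] Y × 𝕜)
  let Φ : E →L[𝕜] E × 𝕜 :=
    (ContinuousLinearMap.id 𝕜 E - J.comp R + (J.comp f₁).comp R).prod (f₂.comp R)
  let Ψ : E × 𝕜 →L[𝕜] E :=
    (ContinuousLinearMap.id 𝕜 E - J.comp R).comp (ContinuousLinearMap.fst 𝕜 E 𝕜) +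
      J.comp ((e.symm : Y × 𝕜 →L[𝕜] Y).comp
        (R.prodMap (ContinuousLinearMap.id 𝕜 𝕜)))
  refine ⟨ContinuousLinearEquiv.equivOfInverse Φ Ψ ?_ ?_⟩
  · intro x
    have : ((e (R x)).1, (e (R x)).2) = e (R x) := rfl
    simp [Φ, Ψ, f₁, f₂, hRJ]
  · rintro ⟨y, c⟩
    simp [Φ, Ψ, f₁, f₂, hRJ]

/-- The left shift splits off the first coordinate of a null sequence. -/
theorem nonempty_equiv_zeroAtInfty_prod : Nonempty (C₀(ℕ, 𝕜) ≃L[𝕜] C₀(ℕ, 𝕜) × 𝕜) := by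
  have hcof : Filter.cocompact ℕ = Filter.atTop := by
    rw [Filter.cocompact_eq_cofinite, Nat.cofinite_eq_atTop]
  let s : C₀(ℕ, 𝕜) →ₗ[𝕜] C₀(ℕ, 𝕜) :=
    { toFun := fun a => ⟨⟨fun n => a (n + 1), continuous_of_discreteTopology⟩, by
        have := a.zero_at_infty'
        rw [hcof] at this ⊢
        exact this.comp (Filter.tendsto_add_atTop_nat 1)⟩
      map_add' := fun _ _ => rfl
      map_smul' := fun _ _ => rfl }
  have hle : ∀ (a : C₀(ℕ, 𝕜)) n, ‖a n‖ ≤ ‖a‖ := fun a n => a.toBCF.norm_coe_le_norm n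
  let S : C₀(ℕ, 𝕜) →L[𝕜] C₀(ℕ, 𝕜) := s.mkContinuous 1 fun a => by
    rw [one_mul]
    exact (BoundedContinuousFunction.norm_le (norm_nonneg a)).2 fun n => hle a (n + 1)
  let z : C₀(ℕ, 𝕜) →ₗ[𝕜] 𝕜 :=
    { toFun := fun a => a 0
      map_add' := fun _ _ => rfl
      map_smul' := fun _ _ => rfl }
  let Z : C₀(ℕ, 𝕜) →L[𝕜] 𝕜 := z.mkContinuous 1 fun a => by
    rw [one_mul]; exact hle a 0
  refine ⟨ContinuousLinearEquiv.ofBijective (S.prod Z) (LinearMap.ker_eq_bot.2 ?_)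
    (LinearMap.range_eq_top.2 ?_)⟩
  · intro a b hab
    have h1 : S a = S b := congrArg Prod.fst hab
    have h2 : Z a = Z b := congrArg Prod.snd hab
    ext n
    cases n with
    | zero => exact h2
    | succ n => exact DFunLike.congr_fun h1 n
  · rintro ⟨a, c⟩
    let b : C₀(ℕ, 𝕜) := ⟨⟨fun n => Nat.casesOn n c a, continuous_of_discreteTopology⟩, by
      have := a.zero_at_infty'
      rw [hcof] at this ⊢
      exact (Filter.tendsto_add_atTop_iff_nat 1).1 this⟩
    exact ⟨b, rfl⟩

/-- A Banach space containing an approximate retract `c₀` absorbs a one-dimensional summand. -/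
theorem nonempty_equiv_prod_of_approx_retract (R : E →L[𝕜] C₀(ℕ, 𝕜)) (J : C₀(ℕ, 𝕜) →L[𝕜] E)
    (hRJ : ∀ a, ‖a - R (J a)‖ ≤ 1 / 2 * ‖a‖) : Nonempty (E ≃L[𝕜] E × 𝕜) := by
  obtain ⟨e⟩ := nonempty_equiv_zeroAtInfty_prod (𝕜 := 𝕜)
  have hlt : ‖(1 : C₀(ℕ, 𝕜) →L[𝕜] C₀(ℕ, 𝕜)) - R.comp J‖ < 1 := by
    refine lt_of_le_of_lt (ContinuousLinearMap.opNorm_le_bound _ (by norm_num) hRJ) (by norm_num)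
  let u := Units.oneSub (1 - R.comp J) hlt
  have hu : (u : C₀(ℕ, 𝕜) →L[𝕜] C₀(ℕ, 𝕜)) = R.comp J :=
    sub_sub_cancel 1 (R.comp J)
  refine nonempty_equiv_prod_of_retract e R (J.comp u⁻¹.val) fun a => ?_
  have := u.mul_inv
  rw [hu] at this
  exact DFunLike.congr_fun this a

/-- A closed subspace absorbing a one-dimensional summand is isomorphic to its sum with any line. -/
theorem nonempty_equiv_sup_span_singleton [CompleteSpace E] (p : Submodule 𝕜 E)
    (hp : IsClosed (p : Set E)) (v : E) (h : Nonempty (p ≃L[𝕜] p × 𝕜)) :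
    Nonempty (p ≃L[𝕜] (p ⊔ Submodule.span 𝕜 {v} : Submodule 𝕜 E)) := by
  by_cases hv : v ∈ p
  · rw [sup_eq_left.2 ((Submodule.span_singleton_le_iff_mem _ _).2 hv)]
    exact ⟨ContinuousLinearEquiv.refl 𝕜 p⟩
  set q : Submodule 𝕜 E := p ⊔ Submodule.span 𝕜 {v} with hq
  have hqc : IsClosed (q : Set E) := Submodule.isClosed_sup_finiteDimensional _ _ hp
  have : CompleteSpace p := hp.completeSpace_coe
  have : CompleteSpace q := hqc.completeSpace_coe
  let T : p × 𝕜 →L[𝕜] E := p.subtypeL.coprod (ContinuousLinearMap.toSpanSingleton 𝕜 v)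
  have hT : ∀ x, T x ∈ q := fun x =>
    Submodule.add_mem_sup x.1.2 (Submodule.smul_mem _ _ (Submodule.mem_span_singleton_self v))
  obtain ⟨e⟩ := h
  refine ⟨e.trans (ContinuousLinearEquiv.ofBijective (T.codRestrict q hT)
    (LinearMap.ker_eq_bot'.2 ?_) (LinearMap.range_eq_top.2 ?_))⟩
  · rintro ⟨x, c⟩ hx
    have hx' : (x : E) + c • v = 0 := congrArg Subtype.val hx
    have hc : c = 0 := by
      by_contra hc
      refine hv ?_
      have : v = c⁻¹ • (-(x : E)) := by
        rw [← eq_neg_of_add_eq_zero_right hx', smul_smul, inv_mul_cancel₀ hc, one_smul]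
      rw [this]
      exact p.smul_mem _ (p.neg_mem x.2)
    subst hc
    have hx0 : x = 0 := Subtype.ext (by simpa using hx')
    rw [hx0]; rfl
  · rintro ⟨y, hy⟩
    obtain ⟨a, ha, b, hb, hab⟩ := Submodule.mem_sup.1 hy
    obtain ⟨c, rfl⟩ := Submodule.mem_span_singleton.1 hb
    exact ⟨(⟨a, ha⟩, c), Subtype.ext hab⟩

/-- If the partial sums of `∑ ‖g j x‖` are at most `1`, then `a ↦ ∑ a j • g j` is a bounded
operator from `c₀` to continuous functions, the series converging uniformly. -/
theorem exists_zeroAtInfty_sum {X : Type*} [TopologicalSpace X] [CompactSpace X] (g : ℕ → C(X, 𝕜))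
    (hg : ∀ (s : Finset ℕ) (x : X), ∑ j ∈ s, ‖g j x‖ ≤ 1) :
    ∃ J : C₀(ℕ, 𝕜) →L[𝕜] C(X, 𝕜), ∀ a, HasSum (fun j => a j • g j) (J a) := by
  have hle : ∀ (a : C₀(ℕ, 𝕜)) n, ‖a n‖ ≤ ‖a‖ := fun a n => a.toBCF.norm_coe_le_norm n
  have hfin : ∀ (a : ℕ → 𝕜) (C : ℝ) (s : Finset ℕ), 0 ≤ C → (∀ j ∈ s, ‖a j‖ ≤ C) →
      ‖∑ j ∈ s, a j • g j‖ ≤ C := by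
    intro a C s hC h
    refine (ContinuousMap.norm_le _ hC).2 fun x => ?_
    rw [ContinuousMap.sum_apply]
    calc ‖∑ j ∈ s, (a j • g j) x‖ ≤ ∑ j ∈ s, ‖(a j • g j) x‖ := norm_sum_le _ _
      _ ≤ ∑ j ∈ s, C * ‖g j x‖ := Finset.sum_le_sum fun j hj => by
          rw [ContinuousMap.smul_apply, norm_smul]
          exact mul_le_mul_of_nonneg_right (h j hj) (norm_nonneg _)
      _ = C * ∑ j ∈ s, ‖g j x‖ := by rw [Finset.mul_sum]
      _ ≤ C * 1 := mul_le_mul_of_nonneg_left (hg s x) hC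
      _ = C := mul_one C
  have hsum : ∀ a : C₀(ℕ, 𝕜), Summable fun j => a j • g j := by
    intro a
    refine summable_iff_vanishing_norm.2 fun ε hε => ?_
    have h0 := a.zero_at_infty'
    rw [Filter.cocompact_eq_cofinite, Nat.cofinite_eq_atTop] at h0
    obtain ⟨N, hN⟩ := Metric.tendsto_atTop.1 h0 (ε / 2) (half_pos hε)
    refine ⟨Finset.range N, fun t ht => ?_⟩
    refine lt_of_le_of_lt (hfin a (ε / 2) t (half_pos hε).le fun j hj => ?_) (half_lt_self hε)
    have hj' : N ≤ j := by
      by_contra hlt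
      exact Finset.disjoint_left.1 ht hj (Finset.mem_range.2 (not_le.1 hlt))
    have := hN j hj'
    rw [dist_zero_right] at this
    exact this.le
  let L : C₀(ℕ, 𝕜) →ₗ[𝕜] C(X, 𝕜) :=
    { toFun := fun a => ∑' j, a j • g j
      map_add' := fun a b => by
        rw [← (hsum a).tsum_add (hsum b)]
        exact tsum_congr fun j => by rw [ZeroAtInftyContinuousMap.add_apply, add_smul]
      map_smul' := fun c a => by
        rw [RingHom.id_apply, ← tsum_const_smul'' c]
        exact tsum_congr fun j => by rw [ZeroAtInftyContinuousMap.smul_apply, smul_assoc] }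
  refine ⟨L.mkContinuous 1 fun a => ?_, fun a => (hsum a).hasSum⟩
  rw [one_mul]
  exact le_of_tendsto (hsum a).hasSum.norm
    (Filter.Eventually.of_forall fun s => hfin a ‖a‖ s (norm_nonneg a) fun j _ => hle a j)

end Banach

/-! ### Coefficients of Müntz polynomials -/

/-- The multiplier `t ^ x ↦ (x - c) / (x + c + 1) * t ^ x`, which annihilates `t ^ c`, is a
contraction for the norm of `L²(0, 1)`, whose square is the quadratic form
`∑ᵢⱼ aᵢ aⱼ / (xᵢ + xⱼ + 1)`: the loss is `2 c + 1` times the square of `∑ᵢ aᵢ / (xᵢ + c + 1)`. -/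
theorem gram_multiplier_le {ι : Type*} (s : Finset ι) (x a : ι → ℝ) (hx : ∀ i ∈ s, 0 < x i)
    (c : ℝ) (hc : 0 < c) :
    ∑ i ∈ s, ∑ j ∈ s, (a i * ((x i - c) / (x i + c + 1))) * (a j * ((x j - c) / (x j + c + 1))) /
      (x i + x j + 1) ≤ ∑ i ∈ s, ∑ j ∈ s, a i * a j / (x i + x j + 1) := by
  rw [← sub_nonneg, ← Finset.sum_sub_distrib]
  have h : ∑ i ∈ s, (∑ j ∈ s, a i * a j / (x i + x j + 1) - ∑ j ∈ s,
      (a i * ((x i - c) / (x i + c + 1))) * (a j * ((x j - c) / (x j + c + 1))) /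
      (x i + x j + 1)) = (2 * c + 1) * (∑ i ∈ s, a i / (x i + c + 1)) ^ 2 := by
    rw [sq, Finset.sum_mul_sum, Finset.mul_sum]
    refine Finset.sum_congr rfl fun i hi => ?_
    rw [← Finset.sum_sub_distrib, Finset.mul_sum]
    refine Finset.sum_congr rfl fun j hj => ?_
    have := hx i hi
    have := hx j hj
    field_simp
    ring
  rw [h]
  positivity

/-- Composing the multipliers that annihilate the powers with index in `r` still gives a
contraction. -/
theorem gram_prod_multiplier_le {ι : Type*} (s r : Finset ι) (x a : ι → ℝ)
    (hx : ∀ i ∈ s, 0 < x i) (hr : r ⊆ s) :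
    ∑ i ∈ s, ∑ j ∈ s, (a i * ∏ m ∈ r, ((x i - x m) / (x i + x m + 1))) *
      (a j * ∏ m ∈ r, ((x j - x m) / (x j + x m + 1))) /
      (x i + x j + 1) ≤ ∑ i ∈ s, ∑ j ∈ s, a i * a j / (x i + x j + 1) := by
  classical
  induction r using Finset.induction_on with
  | empty => simp
  | insert c r hc ih =>
    refine le_trans ?_ (ih fun i hi => hr (Finset.mem_insert_of_mem hi))
    have := gram_multiplier_le s x (fun i => a i * ∏ m ∈ r, ((x i - x m) / (x i + x m + 1))) hx
      (x c) (hx c (hr (Finset.mem_insert_self c r)))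
    refine le_trans (le_of_eq ?_) this
    refine Finset.sum_congr rfl fun i _ => Finset.sum_congr rfl fun j _ => ?_
    rw [Finset.prod_insert hc, Finset.prod_insert hc]
    ring

theorem gram_eq_integral {ι : Type*} (s : Finset ι) (x a : ι → ℝ) (hx : ∀ i ∈ s, 0 < x i) :
    ∫ t in (0 : ℝ)..1, (∑ i ∈ s, a i * t ^ x i) ^ 2 =
      ∑ i ∈ s, ∑ j ∈ s, a i * a j / (x i + x j + 1) := by
  have h : ∀ t ∈ Set.uIcc (0 : ℝ) 1, (∑ i ∈ s, a i * t ^ x i) ^ 2 =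
      ∑ i ∈ s, ∑ j ∈ s, a i * a j * t ^ (x i + x j) := by
    intro t ht
    rw [Set.uIcc_of_le zero_le_one] at ht
    rw [sq, Finset.sum_mul_sum]
    refine Finset.sum_congr rfl fun i hi => Finset.sum_congr rfl fun j hj => ?_
    rw [Real.rpow_add_of_nonneg ht.1 (hx i hi).le (hx j hj).le]
    ring
  rw [intervalIntegral.integral_congr h]
  have hint : ∀ i ∈ s, ∀ j ∈ s, IntervalIntegrable (fun t : ℝ => a i * a j * t ^ (x i + x j))
      MeasureTheory.volume 0 1 := fun i hi j hj =>
    (intervalIntegral.intervalIntegrable_rpow' (by linarith [hx i hi, hx j hj])).const_mul _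
  rw [intervalIntegral.integral_finsetSum]
  · refine Finset.sum_congr rfl fun i hi => ?_
    rw [intervalIntegral.integral_finsetSum (hint i hi)]
    refine Finset.sum_congr rfl fun j hj => ?_
    have := hx i hi
    have := hx j hj
    rw [intervalIntegral.integral_const_mul, integral_rpow (Or.inl (by linarith)),
      Real.one_rpow, Real.zero_rpow (by linarith), sub_zero, mul_one_div]
  · intro i hi
    have h := IntervalIntegrable.sum s (hint i hi)
    rwa [show ∑ j ∈ s, (fun t : ℝ => a i * a j * t ^ (x i + x j)) =
      fun t : ℝ => ∑ j ∈ s, a i * a j * t ^ (x i + x j) from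
        funext fun t => Finset.sum_apply _ _ _] at h

/-- Annihilating all powers but the `k`-th bounds the `k`-th coefficient by the maximum `M` of the
Müntz polynomial. The product is, up to the factor `√(2 x k + 1)`, the `L²` distance of `t ^ x k`
from the span of the other powers. -/
theorem abs_coeff_mul_prod_le {ι : Type*} [DecidableEq ι] (s : Finset ι) (x a : ι → ℝ)
    (hx : ∀ i ∈ s, 0 < x i) (M : ℝ) (hM : 0 ≤ M)
    (hp : ∀ t ∈ Set.Icc (0 : ℝ) 1, |∑ i ∈ s, a i * t ^ x i| ≤ M) (k : ι) (hk : k ∈ s) :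
    |a k| * ∏ m ∈ s.erase k, (|x k - x m| / (x k + x m + 1)) ≤ (2 * x k + 1) * M := by
  have hxk := hx k hk
  have h1 := gram_prod_multiplier_le s (s.erase k) x a hx (Finset.erase_subset _ _)
  rw [← gram_eq_integral s x a hx] at h1
  have h2 : ∫ t in (0 : ℝ)..1, (∑ i ∈ s, a i * t ^ x i) ^ 2 ≤ M ^ 2 := by
    have h := intervalIntegral.norm_integral_le_of_norm_le_const (a := (0 : ℝ)) (b := 1)
      (f := fun t => (∑ i ∈ s, a i * t ^ x i) ^ 2) (C := M ^ 2) (by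
        intro t ht
        rw [Set.uIoc_of_le zero_le_one] at ht
        rw [norm_pow, Real.norm_eq_abs]
        exact pow_le_pow_left₀ (abs_nonneg _) (hp t ⟨ht.1.le, ht.2⟩) 2)
    simpa using (le_abs_self _).trans h
  have hz : ∀ i ∈ s, i ≠ k → ∏ m ∈ s.erase k, ((x i - x m) / (x i + x m + 1)) = 0 :=
    fun i hi hik => Finset.prod_eq_zero (Finset.mem_erase.2 ⟨hik, hi⟩) (by simp)
  rw [Finset.sum_eq_single_of_mem k hk, Finset.sum_eq_single_of_mem k hk] at h1
  · set P := ∏ m ∈ s.erase k, ((x k - x m) / (x k + x m + 1)) with hP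
    have hPabs : ∏ m ∈ s.erase k, (|x k - x m| / (x k + x m + 1)) = |P| := by
      rw [hP, Finset.abs_prod]
      refine Finset.prod_congr rfl fun m hm => ?_
      have := hx m (Finset.mem_of_mem_erase hm)
      rw [abs_div, abs_of_pos (show 0 < x k + x m + 1 by linarith)]
    rw [hPabs, ← abs_mul]
    refine abs_le_of_sq_le_sq ?_ (by positivity)
    have h3 := (div_le_iff₀ (by linarith)).1 (h1.trans h2)
    nlinarith [sq_nonneg M, mul_nonneg hxk.le (sq_nonneg M), mul_nonneg (sq_nonneg (x k)) (sq_nonneg M)]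
  · intro j hj hjk
    rw [hz j hj hjk]; simp
  · intro i hi hik
    rw [hz i hi hik]; simp

/-- The product is the binomial coefficient of `N + A` over `N`. -/
theorem prod_one_add_div_le (A N : ℕ) :
    ∏ i ∈ Finset.range N, (1 + (A : ℝ) / ((i : ℝ) + 1)) ≤ 2 ^ (N + A) := by
  have h : ∏ i ∈ Finset.range N, (1 + (A : ℝ) / ((i : ℝ) + 1)) = ((N + A).choose N : ℝ) := by
    induction N with
    | zero => simp
    | succ n ih =>
      rw [Finset.prod_range_succ, ih]
      have h := Nat.add_one_mul_choose_eq (n + A) n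
      have h' : ((n : ℝ) + A + 1) * ((n + A).choose n : ℝ) =
          ((n + 1 + A).choose (n + 1) : ℝ) * ((n : ℝ) + 1) := by
        rw [show n + 1 + A = n + A + 1 by ring]
        exact_mod_cast h
      field_simp
      linarith
  rw [h]
  exact_mod_cast Nat.choose_le_two_pow _ _

/-- The reciprocal of the product in `abs_coeff_mul_prod_le` grows at most exponentially in `x k`.
The gap condition controls the indices near `k` through binomial coefficients, and the summability
of `1 / x m` controls the remaining ones. -/
theorem exists_prod_le (x : ℕ → ℝ) (hpos : ∀ k, 0 < x k) (g : ℝ) (hg : 0 < g)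
    (hgap : ∀ i n, g * n ≤ x (i + n) - x i) (hsum : Summable fun k => 1 / x k) :
    ∃ D, 0 ≤ D ∧ ∀ (s : Finset ℕ) (k : ℕ), k ∈ s →
      ∏ m ∈ s.erase k, ((x k + x m + 1) / |x k - x m|) ≤ Real.exp (D * (x k + 1)) := by
  set τ := ∑' k, 1 / x k with hτ
  have hτ0 : 0 ≤ τ := tsum_nonneg fun k => (one_div_pos.2 (hpos k)).le
  refine ⟨4 * (2 / g + 1) + 4 * τ, by positivity, fun s k hk => ?_⟩
  have hxk := hpos k
  -- `A` is an integer at least `(2 x k + 1) / g`; indices within `A` of `k` are near, others far.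
  set A : ℕ := ⌈(2 * x k + 1) / g⌉₊ with hA
  have hA1 : (2 * x k + 1) / g ≤ A := Nat.le_ceil _
  have hA2 : (A : ℝ) < (2 * x k + 1) / g + 1 := Nat.ceil_lt_add_one (by positivity)
  have hA1' : 2 * x k + 1 ≤ A * g := (div_le_iff₀ hg).1 hA1
  have hkA : k ≤ A := by
    have h := hgap 0 k
    rw [zero_add] at h
    have h0 := hpos 0
    have : (k : ℝ) * g ≤ A * g := by nlinarith
    exact_mod_cast le_of_mul_le_mul_right this hg
  have hlow : ∀ m, m < k → (x k + x m + 1) / |x k - x m| ≤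
      1 + (A : ℝ) / (((k - 1 - m : ℕ) : ℝ) + 1) := by
    intro m hm
    obtain ⟨d, rfl⟩ := Nat.exists_eq_add_of_lt hm
    have h := hgap m (d + 1)
    rw [← add_assoc] at h
    rw [show m + d + 1 - 1 - m = d by omega]
    push_cast at h
    have hd : 0 < g * ((d : ℝ) + 1) := by positivity
    have hm0 := hpos m
    rw [abs_of_pos (by linarith), div_le_iff₀ (by linarith)]
    have h2 : (A : ℝ) * g ≤ A / ((d : ℝ) + 1) * (x (m + d + 1) - x m) := by
      calc (A : ℝ) * g = A / ((d : ℝ) + 1) * (g * (d + 1)) := by field_simp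
        _ ≤ _ := by gcongr
    nlinarith
  have hhigh : ∀ m, k < m → (x k + x m + 1) / |x k - x m| ≤
      1 + (A : ℝ) / (((m - k - 1 : ℕ) : ℝ) + 1) := by
    intro m hm
    obtain ⟨d, rfl⟩ := Nat.exists_eq_add_of_lt hm
    have h := hgap k (d + 1)
    rw [← add_assoc] at h
    rw [show k + d + 1 - k - 1 = d by omega]
    push_cast at h
    have hd : 0 < g * ((d : ℝ) + 1) := by positivity
    rw [abs_sub_comm, abs_of_pos (by linarith), div_le_iff₀ (by linarith)]
    have h2 : (A : ℝ) * g ≤ A / ((d : ℝ) + 1) * (x (k + d + 1) - x k) := by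
      calc (A : ℝ) * g = A / ((d : ℝ) + 1) * (g * (d + 1)) := by field_simp
        _ ≤ _ := by gcongr
    nlinarith
  have hfar : ∀ m, k + A < m → (x k + x m + 1) / |x k - x m| ≤
      Real.exp (2 * (2 * x k + 1) * (1 / x m)) := by
    intro m hm
    obtain ⟨d, rfl⟩ := Nat.exists_eq_add_of_lt hm
    have h := hgap k (A + d + 1)
    rw [← add_assoc, ← add_assoc] at h
    push_cast at h
    have hm0 := hpos (k + A + d + 1)
    have hge : 2 * x k + 1 ≤ x (k + A + d + 1) - x k := by
      nlinarith [mul_nonneg hg.le (Nat.cast_nonneg (α := ℝ) d)]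
    refine le_trans ?_ (Real.add_one_le_exp _)
    rw [abs_sub_comm, abs_of_pos (by linarith), div_le_iff₀ (by linarith)]
    have h2 : (2 * x k + 1) ≤ 2 * (2 * x k + 1) * (1 / x (k + A + d + 1)) *
        (x (k + A + d + 1) - x k) := by
      rw [mul_one_div, div_mul_eq_mul_div, le_div_iff₀ hm0]
      nlinarith
    nlinarith
  have hone : ∀ m, m ≠ k → 0 ≤ (x k + x m + 1) / |x k - x m| := fun m _ => by
    have := hpos m
    positivity
  have hsplit : ∏ m ∈ s.erase k, ((x k + x m + 1) / |x k - x m|) ≤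
      (∏ m ∈ Finset.range k, (1 + (A : ℝ) / (((k - 1 - m : ℕ) : ℝ) + 1))) *
      (∏ m ∈ Finset.Ioc k (k + A), (1 + (A : ℝ) / (((m - k - 1 : ℕ) : ℝ) + 1))) *
      ∏ m ∈ s.filter (fun m => k + A < m), Real.exp (2 * (2 * x k + 1) * (1 / x m)) := by
    classical
    have hu : s.erase k = ((s.filter (· < k)) ∪ (s.filter (· ∈ Finset.Ioc k (k + A)))) ∪
        s.filter (fun m => k + A < m) := by
      ext m
      simp only [Finset.mem_erase, Finset.mem_union, Finset.mem_filter, Finset.mem_Ioc]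
      constructor
      · rintro ⟨h1, h2⟩
        simp only [h2, true_and]
        omega
      · rintro ((h | h) | h) <;> exact ⟨by omega, h.1⟩
    rw [hu, Finset.prod_union, Finset.prod_union]
    · have hB : ∀ (t u : Finset ℕ) (f F : ℕ → ℝ), t ⊆ u → (∀ m ∈ t, 0 ≤ f m ∧ f m ≤ F m) →
          (∀ m, 1 ≤ F m) → ∏ m ∈ t, f m ≤ ∏ m ∈ u, F m := by
        intro t u f F htu hf hF
        exact (Finset.prod_le_prod (fun m hm => (hf m hm).1) fun m hm => (hf m hm).2).trans
          (Finset.prod_mono_set_of_one_le hF htu)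
      refine mul_le_mul (mul_le_mul ?_ ?_ ?_ ?_) ?_ ?_ ?_
      · refine hB _ _ _ _ ?_ ?_ ?_
        · intro m hm
          exact Finset.mem_range.2 (Finset.mem_filter.1 hm).2
        · intro m hm
          have := (Finset.mem_filter.1 hm).2
          exact ⟨hone m this.ne, hlow m this⟩
        · intro m
          have : (0 : ℝ) ≤ (A : ℝ) / (((k - 1 - m : ℕ) : ℝ) + 1) := by positivity
          linarith
      · refine hB _ _ _ _ ?_ ?_ ?_
        · intro m hm
          exact (Finset.mem_filter.1 hm).2
        · intro m hm
          have := (Finset.mem_Ioc.1 (Finset.mem_filter.1 hm).2).1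
          exact ⟨hone m this.ne', hhigh m this⟩
        · intro m
          have : (0 : ℝ) ≤ (A : ℝ) / (((m - k - 1 : ℕ) : ℝ) + 1) := by positivity
          linarith
      · exact Finset.prod_nonneg fun m hm => hone m
          (Finset.mem_Ioc.1 (Finset.mem_filter.1 hm).2).1.ne'
      · positivity
      · refine hB _ _ _ _ subset_rfl ?_ ?_
        · intro m hm
          have := (Finset.mem_filter.1 hm).2
          exact ⟨hone m (by omega), hfar m this⟩
        · intro m
          have := hpos m
          exact Real.one_le_exp (by positivity)
      · exact Finset.prod_nonneg fun m hm => hone m (by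
          have := (Finset.mem_filter.1 hm).2
          omega)
      · positivity
    · rw [Finset.disjoint_left]
      intro m h1 h2
      simp only [Finset.mem_filter, Finset.mem_Ioc] at h1 h2
      omega
    · rw [Finset.disjoint_left]
      intro m h1 h2
      simp only [Finset.mem_union, Finset.mem_filter, Finset.mem_Ioc] at h1 h2
      omega
  have h1 : ∏ m ∈ Finset.range k, (1 + (A : ℝ) / (((k - 1 - m : ℕ) : ℝ) + 1)) ≤ 2 ^ (A + A) := by
    rw [Finset.prod_range_reflect (fun i => 1 + (A : ℝ) / ((i : ℝ) + 1))]
    refine (prod_one_add_div_le A k).trans ?_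
    exact pow_le_pow_right₀ (by norm_num) (by omega)
  have h2 : ∏ m ∈ Finset.Ioc k (k + A), (1 + (A : ℝ) / (((m - k - 1 : ℕ) : ℝ) + 1)) ≤
      2 ^ (A + A) := by
    refine le_trans (le_of_eq ?_) (prod_one_add_div_le A A)
    rw [← Finset.Ico_add_one_add_one_eq_Ioc, Finset.prod_Ico_eq_prod_range]
    refine Finset.prod_congr (by congr 1; omega) fun i _ => ?_
    rw [show k + 1 + i - k - 1 = i by omega]
  have h3 : ∏ m ∈ s.filter (fun m => k + A < m), Real.exp (2 * (2 * x k + 1) * (1 / x m)) ≤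
      Real.exp (2 * (2 * x k + 1) * τ) := by
    rw [← Real.exp_sum, ← Finset.mul_sum]
    refine Real.exp_le_exp.2 (mul_le_mul_of_nonneg_left ?_ (by positivity))
    exact hsum.sum_le_tsum _ fun m _ => (one_div_pos.2 (hpos m)).le
  have h4 : (2 : ℝ) ^ (A + A) ≤ Real.exp (2 * A) := by
    have : (2 : ℝ) ≤ Real.exp 1 := by linarith [Real.add_one_le_exp (1 : ℝ)]
    calc (2 : ℝ) ^ (A + A) ≤ Real.exp 1 ^ (A + A) := pow_le_pow_left₀ (by norm_num) this _
      _ = Real.exp (2 * A) := by rw [← Real.exp_nat_mul]; push_cast; ring_nf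
  calc _ ≤ _ := hsplit
    _ ≤ Real.exp (2 * A) * Real.exp (2 * A) * Real.exp (2 * (2 * x k + 1) * τ) := by
        refine mul_le_mul (mul_le_mul (h1.trans h4) (h2.trans h4) ?_ ?_) h3 ?_ ?_
        all_goals positivity
    _ ≤ _ := by
        rw [← Real.exp_add, ← Real.exp_add]
        refine Real.exp_le_exp.2 ?_
        have : (2 * x k + 1) / g ≤ 2 / g * (x k + 1) := by
          rw [div_mul_eq_mul_div]
          gcongr
          linarith
        nlinarith

/-- Coefficients of Müntz polynomials grow at most exponentially in the exponent, relative to the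
maximum norm on `[0, 1]`. -/
theorem exists_norm_coeff_le (𝕜 : Type*) [RCLike 𝕜] (x : ℕ → ℝ) (hpos : ∀ k, 0 < x k) (g : ℝ) (hg : 0 < g)
    (hgap : ∀ i n, g * n ≤ x (i + n) - x i) (hsum : Summable fun k => 1 / x k) :
    ∃ D, 0 ≤ D ∧ ∀ (s : Finset ℕ) (a : ℕ → 𝕜) (M : ℝ), 0 ≤ M →
      (∀ t ∈ Set.Icc (0 : ℝ) 1, ‖∑ i ∈ s, a i * ((t ^ x i : ℝ) : 𝕜)‖ ≤ M) → ∀ k ∈ s,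
      ‖a k‖ ≤ Real.exp (D * (x k + 1)) * M := by
  obtain ⟨D, hD0, hD⟩ := exists_prod_le x hpos g hg hgap hsum
  refine ⟨D + 2, by positivity, fun s a M hM hp k hk => ?_⟩
  -- Rotating `a k` to the positive axis and taking real parts reduces to real coefficients.
  obtain ⟨c, hc, hck⟩ : ∃ c : 𝕜, ‖c‖ = 1 ∧ c * a k = (‖a k‖ : 𝕜) := by
    by_cases h0 : a k = 0
    · exact ⟨1, by simp, by simp [h0]⟩
    · refine ⟨(‖a k‖ : 𝕜) / a k, ?_, div_mul_cancel₀ _ h0⟩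
      rw [norm_div, RCLike.norm_ofReal, abs_norm, div_self (norm_ne_zero_iff.2 h0)]
  have hreal := abs_coeff_mul_prod_le s x (fun i => RCLike.re (c * a i)) (fun i _ => hpos i) M hM
    (by
      intro t ht
      have : ∑ i ∈ s, RCLike.re (c * a i) * t ^ x i =
          RCLike.re (c * ∑ i ∈ s, a i * ((t ^ x i : ℝ) : 𝕜)) := by
        rw [Finset.mul_sum, map_sum]
        refine Finset.sum_congr rfl fun i _ => ?_
        rw [← mul_assoc, RCLike.re_mul_ofReal]
      rw [this]
      refine (RCLike.abs_re_le_norm _).trans ?_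
      rw [norm_mul, hc, one_mul]
      exact hp t ht) k hk
  simp only [hck, RCLike.ofReal_re, abs_norm] at hreal
  have hne : ∀ m, m ≠ k → 0 < |x k - x m| := by
    intro m hm
    rw [abs_pos, sub_ne_zero]
    intro h
    rcases lt_or_gt_of_ne hm with hlt | hlt
    · obtain ⟨d, rfl⟩ := Nat.exists_eq_add_of_lt hlt
      have := hgap m (d + 1)
      rw [← add_assoc, h] at this
      push_cast at this
      nlinarith [mul_nonneg hg.le (Nat.cast_nonneg (α := ℝ) d)]
    · obtain ⟨d, rfl⟩ := Nat.exists_eq_add_of_lt hlt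
      have := hgap k (d + 1)
      rw [← add_assoc, ← h] at this
      push_cast at this
      nlinarith [mul_nonneg hg.le (Nat.cast_nonneg (α := ℝ) d)]
  have hinv : (∏ m ∈ s.erase k, (|x k - x m| / (x k + x m + 1))) *
      ∏ m ∈ s.erase k, ((x k + x m + 1) / |x k - x m|) = 1 := by
    rw [← Finset.prod_mul_distrib]
    refine Finset.prod_eq_one fun m hm => ?_
    have h1 := hne m (Finset.ne_of_mem_erase hm)
    have h2 := hpos m
    have h3 := hpos k
    field_simp
  have hxk := hpos k
  have hPn : 0 ≤ ∏ m ∈ s.erase k, ((x k + x m + 1) / |x k - x m|) :=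
    Finset.prod_nonneg fun m _ => by have := hpos m; positivity
  have h5 : 2 * x k + 1 ≤ Real.exp (2 * (x k + 1)) := by
    linarith [Real.add_one_le_exp (2 * (x k + 1))]
  calc ‖a k‖ = ‖a k‖ * (∏ m ∈ s.erase k, (|x k - x m| / (x k + x m + 1))) *
        ∏ m ∈ s.erase k, ((x k + x m + 1) / |x k - x m|) := by rw [mul_assoc, hinv, mul_one]
    _ ≤ (2 * x k + 1) * M * Real.exp (D * (x k + 1)) := by
        refine mul_le_mul hreal (hD s k hk) hPn (by positivity)
    _ ≤ Real.exp (2 * (x k + 1)) * M * Real.exp (D * (x k + 1)) := by gcongr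
    _ = Real.exp ((D + 2) * (x k + 1)) * M := by
        rw [add_mul, Real.exp_add]; ring

/-! ### Müntz spaces: multiplication by powers and change of variables -/

section Muntz

variable (𝕜 : Type*) [RCLike 𝕜]

open scoped ZeroAtInfty

/-- The power `t ↦ t ^ l` as a continuous function on `[0, 1]`. The exponent is truncated at `0`, so
that the function is continuous for every real `l`; only `0 ≤ l` is of interest. -/
noncomputable def powMap (l : ℝ) : C(I, 𝕜) where
  toFun t := (((t : ℝ) ^ max l 0 : ℝ) : 𝕜)
  continuous_toFun := RCLike.continuous_ofReal.comp
    ((Real.continuous_rpow_const (le_max_right l 0)).comp continuous_subtype_val)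

variable {𝕜}

theorem powMap_apply {l : ℝ} (hl : 0 ≤ l) (t : I) : powMap 𝕜 l t = (((t : ℝ) ^ l : ℝ) : 𝕜) := by
  simp [powMap, hl]

theorem muntzMonomials_eq_image {S : Set ℝ} (hS : S ⊆ Set.Ioi 0) :
    muntzMonomials 𝕜 S = powMap 𝕜 '' S := by
  ext f
  constructor
  · rintro ⟨l, hl, h⟩
    exact ⟨l, hl, by ext t; rw [h, powMap_apply (hS hl).le]⟩
  · rintro ⟨l, hl, rfl⟩
    exact ⟨l, hl, powMap_apply (hS hl).le⟩

theorem powMap_mul {a b : ℝ} (ha : 0 ≤ a) (hb : 0 ≤ b) :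
    powMap 𝕜 a * powMap 𝕜 b = powMap 𝕜 (b + a) := by
  ext t
  rw [ContinuousMap.mul_apply, powMap_apply ha, powMap_apply hb, powMap_apply (by positivity),
    add_comm, Real.rpow_add_of_nonneg t.2.1 ha hb, RCLike.ofReal_mul]

/-- Changing variables `t = u ^ α` shows that dilating the exponents does not change the
isomorphism type of a Müntz space. -/
theorem nonempty_muntzSpace_equiv_mul {S : Set ℝ} (hS : S ⊆ Set.Ioi 0) {α : ℝ} (hα : 0 < α) :
    Nonempty (muntzSpace 𝕜 S ≃L[𝕜] muntzSpace 𝕜 ((fun x => α * x) '' S)) := by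
  let φ : C(I, I) :=
    { toFun := fun t => ⟨(t : ℝ) ^ α, Real.rpow_nonneg t.2.1 _, Real.rpow_le_one t.2.1 t.2.2 hα.le⟩
      continuous_toFun := Continuous.subtype_mk
        ((Real.continuous_rpow_const hα.le).comp continuous_subtype_val) _ }
  have hφ : Function.Surjective φ := fun t => by
    refine ⟨⟨(t : ℝ) ^ α⁻¹, Real.rpow_nonneg t.2.1 _,
      Real.rpow_le_one t.2.1 t.2.2 (inv_pos.2 hα).le⟩, Subtype.ext ?_⟩
    exact Real.rpow_inv_rpow t.2.1 hα.ne'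
  let T₀ : C(I, 𝕜) →ₗ[𝕜] C(I, 𝕜) :=
    { toFun := fun f => f.comp φ
      map_add' := fun _ _ => rfl
      map_smul' := fun _ _ => rfl }
  let T : C(I, 𝕜) →L[𝕜] C(I, 𝕜) := T₀.mkContinuous 1 fun f => by
    rw [one_mul]
    exact (ContinuousMap.norm_le _ (norm_nonneg f)).2 fun t => f.norm_coe_le_norm (φ t)
  have himg : (fun x => α * x) '' S ⊆ Set.Ioi 0 := by
    rintro _ ⟨x, hx, rfl⟩
    exact mul_pos hα (hS hx)
  have hTA : powMap 𝕜 '' ((fun x => α * x) '' S) = T '' (powMap 𝕜 '' S) := by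
    rw [Set.image_image, Set.image_image]
    refine Set.image_congr fun l hl => ?_
    have hl0 : 0 < l := hS hl
    ext t
    change _ = powMap 𝕜 l (φ t)
    rw [powMap_apply (by positivity), powMap_apply hl0.le, Real.rpow_mul t.2.1]
    rfl
  unfold muntzSpace
  rw [muntzMonomials_eq_image hS, muntzMonomials_eq_image himg, hTA]
  refine nonempty_equiv_closure_span_image T _ 1 fun f _ => ?_
  rw [one_mul]
  refine (ContinuousMap.norm_le _ (norm_nonneg _)).2 fun t => ?_
  obtain ⟨u, rfl⟩ := hφ t
  exact (T f).norm_coe_le_norm u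

/-- On the Müntz polynomials with exponents `l k`, multiplication by `t ^ β` is bounded below for
the maximum norm. -/
theorem exists_norm_le_norm_powMap_mul (l : ℕ → ℝ) (hpos : ∀ k, 0 < l k) (g : ℝ) (hg : 0 < g)
    (hgap : ∀ i n, g * n ≤ l (i + n) - l i) (hsum : Summable fun k => 1 / l k)
    {β : ℝ} (hβ : 0 ≤ β) :
    ∃ K, ∀ f ∈ Submodule.span 𝕜 (powMap 𝕜 '' Set.range l), ‖f‖ ≤ K * ‖powMap 𝕜 β * f‖ := by
  have hpos' : ∀ k, 0 < l k + β := fun k => add_pos_of_pos_of_nonneg (hpos k) hβ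
  have hsum' : Summable fun k => 1 / (l k + β) :=
    hsum.of_nonneg_of_le (fun k => (one_div_pos.2 (hpos' k)).le)
      fun k => one_div_le_one_div_of_le (hpos k) (by linarith)
  obtain ⟨D, hD0, hD⟩ := exists_norm_coeff_le 𝕜 (fun k => l k + β) hpos' g hg
    (fun i n => by simpa using hgap i n) hsum'
  set S := ∑' k, 1 / l k with hS
  have hS0 : 0 ≤ S := tsum_nonneg fun k => (one_div_pos.2 (hpos k)).le
  -- Below `δ` the coefficient bounds sum up, above `δ` the factor `t ^ β` is at least `δ ^ β`.
  set δ := Real.exp (-(D + 1)) with hδ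
  have hδ0 : 0 < δ := Real.exp_pos _
  have hK1 : 0 ≤ Real.exp (D * (β + 1)) * S := by positivity
  have hK2 : 0 ≤ (δ ^ β)⁻¹ := by positivity
  refine ⟨Real.exp (D * (β + 1)) * S + (δ ^ β)⁻¹, fun f hf => ?_⟩
  rw [← Set.range_comp] at hf
  obtain ⟨c, rfl⟩ := Finsupp.mem_span_range_iff_exists_finsupp.1 hf
  set f := c.sum fun i a => a • (powMap 𝕜 ∘ l) i with hfdef
  set M := ‖powMap 𝕜 β * f‖ with hM
  have hM0 : 0 ≤ M := norm_nonneg _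
  have hfx : ∀ t : I, f t = ∑ i ∈ c.support, c i * (((t : ℝ) ^ l i : ℝ) : 𝕜) := by
    intro t
    rw [hfdef, Finsupp.sum, ContinuousMap.sum_apply]
    refine Finset.sum_congr rfl fun i _ => ?_
    rw [ContinuousMap.smul_apply, Function.comp_apply, powMap_apply (hpos i).le, smul_eq_mul]
  have hFx : ∀ t : I, (powMap 𝕜 β * f) t = (((t : ℝ) ^ β : ℝ) : 𝕜) * f t := fun t => by
    rw [ContinuousMap.mul_apply, powMap_apply hβ]
  have hcoef : ∀ k ∈ c.support, ‖c k‖ ≤ Real.exp (D * (l k + β + 1)) * M := by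
    refine hD c.support c M hM0 fun t ht => ?_
    have h := (powMap 𝕜 β * f).norm_coe_le_norm ⟨t, ht⟩
    rw [hFx, hfx, Finset.mul_sum] at h
    refine (congrArg norm (Finset.sum_congr rfl fun i _ => ?_)).le.trans h
    rw [Real.rpow_add_of_nonneg ht.1 (hpos _).le hβ, RCLike.ofReal_mul]
    ring
  refine (ContinuousMap.norm_le _ (by positivity)).2 fun t => ?_
  rcases le_total (t : ℝ) δ with ht | ht
  · refine le_trans ?_ (mul_le_mul_of_nonneg_right (le_add_of_nonneg_right hK2) hM0)
    rw [hfx]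
    calc ‖∑ i ∈ c.support, c i * (((t : ℝ) ^ l i : ℝ) : 𝕜)‖
        ≤ ∑ i ∈ c.support, ‖c i * (((t : ℝ) ^ l i : ℝ) : 𝕜)‖ := norm_sum_le _ _
      _ ≤ ∑ i ∈ c.support, Real.exp (D * (β + 1)) * M * (1 / l i) := by
          refine Finset.sum_le_sum fun i hi => ?_
          have hli := hpos i
          rw [norm_mul, RCLike.norm_ofReal, abs_of_nonneg (Real.rpow_nonneg t.2.1 _)]
          have h1 : (t : ℝ) ^ l i ≤ Real.exp (-(D + 1) * l i) := by
            rw [Real.exp_mul]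
            exact Real.rpow_le_rpow t.2.1 ht hli.le
          have h2 : Real.exp (-(l i)) ≤ 1 / l i := by
            rw [Real.exp_neg, ← one_div]
            exact one_div_le_one_div_of_le hli (by linarith [Real.add_one_le_exp (l i)])
          calc ‖c i‖ * (t : ℝ) ^ l i
              ≤ Real.exp (D * (l i + β + 1)) * M * Real.exp (-(D + 1) * l i) :=
                mul_le_mul (hcoef i hi) h1 (Real.rpow_nonneg t.2.1 _) (by positivity)
            _ = Real.exp (D * (β + 1)) * M * Real.exp (-(l i)) := by
                rw [mul_right_comm, ← Real.exp_add, mul_right_comm (Real.exp (D * (β + 1))),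
                  ← Real.exp_add]
                ring_nf
            _ ≤ _ := by gcongr
      _ = Real.exp (D * (β + 1)) * M * ∑ i ∈ c.support, 1 / l i := by rw [Finset.mul_sum]
      _ ≤ Real.exp (D * (β + 1)) * M * S := by
          gcongr
          exact hsum.sum_le_tsum _ fun k _ => (one_div_pos.2 (hpos k)).le
      _ = _ := by ring
  · refine le_trans ?_ (mul_le_mul_of_nonneg_right (le_add_of_nonneg_left hK1) hM0)
    have h := (powMap 𝕜 β * f).norm_coe_le_norm t
    rw [hFx, norm_mul, RCLike.norm_ofReal, abs_of_nonneg (Real.rpow_nonneg t.2.1 _)] at h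
    rw [inv_mul_eq_div, le_div_iff₀ (by positivity), mul_comm]
    refine le_trans ?_ h
    gcongr

/-- Multiplication by `t ^ β` shows that translating the exponents does not change the
isomorphism type of a Müntz space. -/
theorem nonempty_muntzSpace_equiv_add (l : ℕ → ℝ) (hpos : ∀ k, 0 < l k) (g : ℝ) (hg : 0 < g)
    (hgap : ∀ i n, g * n ≤ l (i + n) - l i) (hsum : Summable fun k => 1 / l k)
    {β : ℝ} (hβ : 0 ≤ β) :
    Nonempty (muntzSpace 𝕜 (Set.range l) ≃L[𝕜]
      muntzSpace 𝕜 ((fun x => x + β) '' Set.range l)) := by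
  have hS : Set.range l ⊆ Set.Ioi 0 := by
    rintro _ ⟨k, rfl⟩
    exact hpos k
  have himg : (fun x => x + β) '' Set.range l ⊆ Set.Ioi 0 := by
    rintro _ ⟨x, hx, rfl⟩
    exact add_pos_of_pos_of_nonneg (hS hx) hβ
  obtain ⟨K, hK⟩ := exists_norm_le_norm_powMap_mul (𝕜 := 𝕜) l hpos g hg hgap hsum hβ
  have hTA : powMap 𝕜 '' ((fun x => x + β) '' Set.range l) =
      ContinuousLinearMap.mul 𝕜 C(I, 𝕜) (powMap 𝕜 β) '' (powMap 𝕜 '' Set.range l) := by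
    rw [Set.image_image, Set.image_image]
    refine Set.image_congr fun x hx => ?_
    rw [ContinuousLinearMap.mul_apply', powMap_mul hβ (hS hx).le]
  unfold muntzSpace
  rw [muntzMonomials_eq_image hS, muntzMonomials_eq_image himg, hTA]
  exact nonempty_equiv_closure_span_image _ _ K hK

/-! ### Müntz spaces: adjoining exponents -/

/-- An unbounded set of exponents contains a lacunary sequence. -/
theorem exists_lacunary_seq {S : Set ℝ} (hunb : ¬ BddAbove S) (c : ℝ) :
    ∃ μ : ℕ → ℝ, (∀ n, μ n ∈ S) ∧ (∀ n, c * μ n ≤ μ (n + 1)) := by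
  have hex : ∀ y : ℝ, ∃ x ∈ S, y < x := fun y => by
    by_contra! h
    exact hunb ⟨y, h⟩
  choose F hF using hex
  let μ : ℕ → ℝ := fun n => Nat.rec (F 0) (fun _ y => F (c * y)) n
  refine ⟨μ, fun n => ?_, fun n => (hF (c * μ n)).2.le⟩
  cases n with
  | zero => exact (hF 0).1
  | succ n => exact (hF (c * μ n)).1

/-- A Müntz space with unbounded exponents absorbs a one-dimensional summand, because it contains
a complemented copy of `c₀`: for lacunary exponents `μ j` the differences `t ^ μ j - t ^ μ (j + 1)`
span it, and evaluation at points `t i` where the `i`-th difference is nearly `1` is an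
approximate retraction. -/
theorem nonempty_muntzSpace_equiv_prod {S : Set ℝ} (hS : S ⊆ Set.Ioi 0) (hunb : ¬ BddAbove S) :
    Nonempty (muntzSpace 𝕜 S ≃L[𝕜] muntzSpace 𝕜 S × 𝕜) := by
  obtain ⟨μ, hμS, hμ⟩ := exists_lacunary_seq hunb 16
  have hμ0 : ∀ n, 0 < μ n := fun n => hS (hμS n)
  have hanti : ∀ x : I, Antitone fun j => (x : ℝ) ^ μ j := fun x =>
    antitone_nat_of_succ_le fun n => Real.rpow_le_rpow_of_exponent_ge_of_imp x.2.1 x.2.2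
      (by linarith [hμ n, hμ0 n]) fun _ h => absurd h (hμ0 (n + 1)).ne'
  have hgrow : ∀ n : ℕ, μ 0 * ((n : ℝ) + 1) ≤ μ n := by
    intro n
    induction n with
    | zero => simp
    | succ n ih => push_cast; nlinarith [hμ n, hμ0 n, hμ0 0, Nat.cast_nonneg (α := ℝ) n]
  -- The peaks: `t i ^ μ i = 7 / 8`, while lacunarity makes `t i ^ μ (i + 1)` at most `1 / 8`.
  let t : ℕ → I := fun n => ⟨(7 / 8 : ℝ) ^ (μ n)⁻¹, by positivity,
    Real.rpow_le_one (by norm_num) (by norm_num) (inv_pos.2 (hμ0 n)).le⟩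
  have ht1 : ∀ n, (t n : ℝ) ^ μ n = 7 / 8 := fun n =>
    Real.rpow_inv_rpow (by norm_num) (hμ0 n).ne'
  have ht2 : ∀ n, (t n : ℝ) ^ μ (n + 1) ≤ 1 / 8 := by
    intro n
    have h1 : (t n : ℝ) ^ μ (n + 1) ≤ (t n : ℝ) ^ (16 * μ n) :=
      Real.rpow_le_rpow_of_exponent_ge_of_imp (t n).2.1 (t n).2.2 (hμ n)
        fun _ h => absurd h (hμ0 (n + 1)).ne'
    refine h1.trans ?_
    rw [mul_comm, Real.rpow_mul (t n).2.1, ht1]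
    rw [show (16 : ℝ) = (16 : ℕ) by norm_num, Real.rpow_natCast]
    norm_num
  have htlim : Filter.Tendsto t Filter.atTop (nhds 1) := by
    rw [tendsto_subtype_rng]
    have hinv : Filter.Tendsto (fun n => (μ n)⁻¹) Filter.atTop (nhds 0) := by
      refine Filter.Tendsto.comp tendsto_inv_atTop_zero
        (Filter.tendsto_atTop_mono hgrow ?_)
      exact Filter.Tendsto.const_mul_atTop (hμ0 0)
        (Filter.tendsto_atTop_add_const_right _ _ tendsto_natCast_atTop_atTop)
    have h := (tendsto_const_nhds (x := (7 / 8 : ℝ))).rpow hinv (Or.inl (by norm_num))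
    rw [Real.rpow_zero] at h
    exact h
  let E := muntzSpace 𝕜 S
  let g : ℕ → C(I, 𝕜) := fun j => powMap 𝕜 (μ j) - powMap 𝕜 (μ (j + 1))
  have hgx : ∀ j (x : I), g j x = (((x : ℝ) ^ μ j - (x : ℝ) ^ μ (j + 1) : ℝ) : 𝕜) := fun j x => by
    change powMap 𝕜 (μ j) x - powMap 𝕜 (μ (j + 1)) x = _
    rw [powMap_apply (hμ0 _).le, powMap_apply (hμ0 _).le, RCLike.ofReal_sub]
  have hgn : ∀ j (x : I), ‖g j x‖ = (x : ℝ) ^ μ j - (x : ℝ) ^ μ (j + 1) := fun j x => by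
    rw [hgx, RCLike.norm_ofReal, abs_of_nonneg (sub_nonneg.2 (hanti x (Nat.le_succ j)))]
  have hgE : ∀ j, g j ∈ E := by
    have : ∀ j, powMap 𝕜 (μ j) ∈ E := fun j =>
      Submodule.le_topologicalClosure _ (Submodule.subset_span
        (by rw [muntzMonomials_eq_image hS]; exact ⟨_, hμS j, rfl⟩))
    exact fun j => E.sub_mem (this j) (this (j + 1))
  have hgsum : ∀ (s : Finset ℕ) (x : I), ∑ j ∈ s, ‖g j x‖ ≤ 1 := by
    intro s x
    obtain ⟨N, hN⟩ := s.exists_nat_subset_range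
    calc ∑ j ∈ s, ‖g j x‖ ≤ ∑ j ∈ Finset.range N, ‖g j x‖ :=
          Finset.sum_le_sum_of_subset_of_nonneg hN fun _ _ _ => norm_nonneg _
      _ = (x : ℝ) ^ μ 0 - (x : ℝ) ^ μ N := by
          simp only [hgn]
          exact Finset.sum_range_sub' _ _
      _ ≤ 1 := by
          have := Real.rpow_le_one x.2.1 x.2.2 (hμ0 0).le
          have := Real.rpow_nonneg x.2.1 (μ N)
          linarith
  obtain ⟨J₀, hJ₀⟩ := exists_zeroAtInfty_sum g hgsum
  have hJE : ∀ a, J₀ a ∈ E := fun a =>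
    (Submodule.isClosed_topologicalClosure _).mem_of_tendsto (hJ₀ a)
      (Filter.Eventually.of_forall fun s => E.sum_mem fun j _ => E.smul_mem _ (hgE j))
  let J : C₀(ℕ, 𝕜) →L[𝕜] E := J₀.codRestrict E hJE
  let R₀ : C(I, 𝕜) →ₗ[𝕜] C₀(ℕ, 𝕜) :=
    { toFun := fun f => ⟨⟨fun n => f (t n) - f 1, continuous_of_discreteTopology⟩, by
        rw [Filter.cocompact_eq_cofinite, Nat.cofinite_eq_atTop]
        have := ((f.continuous.tendsto 1).comp htlim).sub_const (f 1)
        rwa [sub_self] at this⟩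
      map_add' := fun f h => by
        ext n
        exact add_sub_add_comm _ _ _ _
      map_smul' := fun c f => by
        ext n
        exact (mul_sub c _ _).symm }
  let R : C(I, 𝕜) →L[𝕜] C₀(ℕ, 𝕜) := R₀.mkContinuous 2 fun f => by
    refine (BoundedContinuousFunction.norm_le (by positivity)).2 fun n => ?_
    change ‖f (t n) - f 1‖ ≤ _
    linarith [norm_sub_le (f (t n)) (f 1), f.norm_coe_le_norm (t n), f.norm_coe_le_norm 1]
  have hRx : ∀ f n, R f n = f (t n) - f 1 := fun _ _ => rfl
  have hle : ∀ (a : C₀(ℕ, 𝕜)) n, ‖a n‖ ≤ ‖a‖ := fun a n => a.toBCF.norm_coe_le_norm n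
  refine nonempty_equiv_prod_of_approx_retract (E := E) (R.comp E.subtypeL) J fun a => ?_
  refine (BoundedContinuousFunction.norm_le (by positivity)).2 fun n => ?_
  change ‖a n - R (J₀ a) n‖ ≤ 1 / 2 * ‖a‖
  have hJ1 : J₀ a 1 = 0 := by
    have h := (hJ₀ a).map (ContinuousMap.evalCLM 𝕜 (1 : I))
      (ContinuousMap.evalCLM 𝕜 (1 : I)).continuous
    refine h.unique ?_
    convert hasSum_zero with j
    simp [hgx]
  have hJn : HasSum (fun j => a j * g j (t n)) (J₀ a (t n)) :=
    (hJ₀ a).map (ContinuousMap.evalCLM 𝕜 (t n)) (ContinuousMap.evalCLM 𝕜 (t n)).continuous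
  rw [hRx, hJ1, sub_zero]
  have hdiff : Filter.Tendsto (fun N => ‖a n - ∑ j ∈ Finset.range N, a j * g j (t n)‖)
      Filter.atTop (nhds ‖a n - J₀ a (t n)‖) :=
    (tendsto_const_nhds.sub hJn.tendsto_sum_nat).norm
  refine le_of_tendsto hdiff (Filter.eventually_atTop.2 ⟨n + 1, fun N hN => ?_⟩)
  -- The off-diagonal sums telescope, to at most `1 / 8` on either side of `n`.
  have hn := hgn n (t n)
  have hgn' := hgx n (t n)
  have hd := ht1 n
  have hd2 := ht2 n
  have hsplit : a n - ∑ j ∈ Finset.range N, a j * g j (t n) = a n * (1 - g n (t n)) -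
      ∑ j ∈ Finset.range n, a j * g j (t n) - ∑ j ∈ Finset.Ico (n + 1) N, a j * g j (t n) := by
    rw [Finset.range_eq_Ico, ← Finset.sum_Ico_consecutive _ (Nat.zero_le n) (by omega : n ≤ N),
      Finset.sum_eq_sum_Ico_succ_bot (by omega : n < N), Finset.range_eq_Ico]
    ring
  have hbound : ∀ s : Finset ℕ, ‖∑ j ∈ s, a j * g j (t n)‖ ≤ ‖a‖ * ∑ j ∈ s, ‖g j (t n)‖ := by
    intro s
    rw [Finset.mul_sum]
    refine (norm_sum_le _ _).trans (Finset.sum_le_sum fun j _ => ?_)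
    rw [norm_mul]
    exact mul_le_mul_of_nonneg_right (hle a j) (norm_nonneg _)
  have h1 : ∑ j ∈ Finset.range n, ‖g j (t n)‖ ≤ 1 / 8 := by
    simp only [hgn]
    rw [Finset.sum_range_sub', hd]
    have := Real.rpow_le_one (t n).2.1 (t n).2.2 (hμ0 0).le
    linarith
  have h2 : ∑ j ∈ Finset.Ico (n + 1) N, ‖g j (t n)‖ ≤ 1 / 8 := by
    simp only [hgn]
    rw [← neg_le_neg_iff, ← Finset.sum_neg_distrib]
    simp only [neg_sub]
    rw [Finset.sum_Ico_sub (fun j => (t n : ℝ) ^ μ j) hN]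
    have := Real.rpow_nonneg (t n).2.1 (μ N)
    linarith
  have h3 : ‖1 - g n (t n)‖ ≤ 1 / 4 := by
    rw [hgn', ← RCLike.ofReal_one, ← RCLike.ofReal_sub, RCLike.norm_ofReal, hd]
    have := Real.rpow_nonneg (t n).2.1 (μ (n + 1))
    rw [abs_of_nonneg (by linarith)]
    linarith
  rw [hsplit]
  have ha := norm_nonneg a
  calc _ ≤ ‖a n * (1 - g n (t n))‖ + ‖∑ j ∈ Finset.range n, a j * g j (t n)‖ +
        ‖∑ j ∈ Finset.Ico (n + 1) N, a j * g j (t n)‖ :=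
        (norm_sub_le _ _).trans (add_le_add_left (norm_sub_le _ _) _)
    _ ≤ ‖a‖ * (1 / 4) + ‖a‖ * (1 / 8) + ‖a‖ * (1 / 8) := by
        refine add_le_add (add_le_add ?_ ?_) ?_
        · rw [norm_mul]
          exact mul_le_mul (hle a n) h3 (norm_nonneg _) ha
        · exact (hbound _).trans (mul_le_mul_of_nonneg_left h1 ha)
        · exact (hbound _).trans (mul_le_mul_of_nonneg_left h2 ha)
    _ = 1 / 2 * ‖a‖ := by ring

theorem muntzSpace_insert {S : Set ℝ} (hS : S ⊆ Set.Ioi 0) {ξ : ℝ} (hξ : 0 < ξ) :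
    muntzSpace 𝕜 (insert ξ S) = muntzSpace 𝕜 S ⊔ Submodule.span 𝕜 {powMap 𝕜 ξ} := by
  have hins : insert ξ S ⊆ Set.Ioi 0 := Set.insert_subset hξ hS
  unfold muntzSpace
  rw [muntzMonomials_eq_image hS, muntzMonomials_eq_image hins, Set.image_insert_eq,
    Submodule.span_insert]
  refine le_antisymm (Submodule.topologicalClosure_minimal _ ?_ ?_) (sup_le ?_ ?_)
  · exact sup_le le_sup_right ((Submodule.le_topologicalClosure _).trans le_sup_left)
  · exact Submodule.isClosed_sup_finiteDimensional _ _ (Submodule.isClosed_topologicalClosure _)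
  · exact Submodule.topologicalClosure_mono le_sup_right
  · exact le_sup_left.trans (Submodule.le_topologicalClosure _)

/-- Adjoining finitely many exponents to an unbounded set of exponents does not change the
isomorphism type of the Müntz space. -/
theorem nonempty_muntzSpace_equiv_union {S : Set ℝ} (hS : S ⊆ Set.Ioi 0) (hunb : ¬ BddAbove S)
    {Ξ : Set ℝ} (hfin : Ξ.Finite) (hΞ : Ξ ⊆ Set.Ioi 0) :
    Nonempty (muntzSpace 𝕜 S ≃L[𝕜] muntzSpace 𝕜 (Ξ ∪ S)) := by
  induction Ξ, hfin using Set.Finite.induction_on with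
  | empty => rw [Set.empty_union]; exact ⟨ContinuousLinearEquiv.refl 𝕜 _⟩
  | @insert ξ Ξ _ _ ih =>
    have hΞ' : Ξ ⊆ Set.Ioi 0 := (Set.subset_insert _ _).trans hΞ
    have hu : Ξ ∪ S ⊆ Set.Ioi 0 := Set.union_subset hΞ' hS
    have hub : ¬ BddAbove (Ξ ∪ S) := fun h => hunb (h.mono Set.subset_union_right)
    obtain ⟨e⟩ := ih hΞ'
    rw [Set.insert_union, muntzSpace_insert hu (hΞ (Set.mem_insert _ _))]
    obtain ⟨e'⟩ := nonempty_equiv_sup_span_singleton (muntzSpace 𝕜 (Ξ ∪ S))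
      (Submodule.isClosed_topologicalClosure _) (powMap 𝕜 ξ)
      (nonempty_muntzSpace_equiv_prod hu hub)
    exact ⟨e.trans e'⟩

end Muntz

/-! ### Affine change of the exponents -/

theorem GapCondition.exists_mul_le {l : ℕ → ℝ} (hgap : GapCondition l) :
    ∃ g, 0 < g ∧ ∀ i n, g * n ≤ l (i + n) - l i := by
  have hbdd : BddBelow (Set.range fun k => l (k + 1) - l k) := by
    by_contra h
    have := Real.iInf_of_not_bddBelow h
    rw [GapCondition, this] at hgap
    exact lt_irrefl _ hgap
  refine ⟨_, hgap, fun i n => ?_⟩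
  induction n with
  | zero => simp
  | succ n ih =>
    have := ciInf_le hbdd (i + n)
    rw [← add_assoc]
    push_cast
    linarith

theorem lemma4 {𝕜 : Type*} [RCLike 𝕜] (l : ℕ → ℝ) (hpos : ∀ k, 0 < l k) (hmono : StrictMono l)
    (hgap : GapCondition l) (hmuntz : MuntzCondition l)
    (Ξ : Set ℝ) (hΞfin : Ξ.Finite) (hΞ : Ξ ⊆ Set.Ioi 0)
    (α β : ℝ) (hα : 0 < α) (hβ : 0 ≤ β) :
    Nonempty (muntzSpace 𝕜 (Set.range l) ≃L[𝕜]
      muntzSpace 𝕜 (Ξ ∪ (fun x : ℝ => α * x + β) '' Set.range l)) := by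
  obtain ⟨g, hg, hgl⟩ := hgap.exists_mul_le
  have hβα : 0 ≤ β / α := div_nonneg hβ hα.le
  have hS₁ : (fun x => x + β / α) '' Set.range l ⊆ Set.Ioi 0 := by
    rintro _ ⟨_, ⟨k, rfl⟩, rfl⟩
    exact add_pos_of_pos_of_nonneg (hpos k) hβα
  have hS₂ : (fun x : ℝ => α * x + β) '' Set.range l ⊆ Set.Ioi 0 := by
    rintro _ ⟨_, ⟨k, rfl⟩, rfl⟩
    exact add_pos_of_pos_of_nonneg (mul_pos hα (hpos k)) hβ
  have hunb : ¬ BddAbove ((fun x : ℝ => α * x + β) '' Set.range l) := by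
    rintro ⟨B, hB⟩
    obtain ⟨n, hn⟩ := exists_nat_gt (B / (α * g))
    have h1 : α * l n + β ≤ B := hB ⟨_, ⟨n, rfl⟩, rfl⟩
    have h2 := hgl 0 n
    rw [zero_add] at h2
    rw [div_lt_iff₀ (by positivity)] at hn
    nlinarith [hpos 0]
  -- The affine map `x ↦ α x + β` is the translation by `β / α` followed by the dilation by `α`.
  have himg : (fun x => α * x) '' ((fun x => x + β / α) '' Set.range l) =
      (fun x : ℝ => α * x + β) '' Set.range l := by
    rw [Set.image_image]
    refine Set.image_congr fun x _ => ?_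
    field_simp
  obtain ⟨e₁⟩ := nonempty_muntzSpace_equiv_add (𝕜 := 𝕜) l hpos g hg hgl hmuntz hβα
  obtain ⟨e₂⟩ := nonempty_muntzSpace_equiv_mul (𝕜 := 𝕜) hS₁ hα
  rw [himg] at e₂
  obtain ⟨e₃⟩ := nonempty_muntzSpace_equiv_union (𝕜 := 𝕜) hS₂ hunb hΞfin hΞ
  exact ⟨(e₁.trans e₂).trans e₃⟩
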